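/- Let $k,N\ge 1$ be integers, let $\theta_1,\dots,\theta_N$ be distinct non-zero real numbers, let $\lambda\in\mathbb R$, and let $p_j\in(1,\infty]$, $\lambda_j\in\mathbb R$ for $j=0,\dots,N$ (with $1/\infty=0$). For $p\in(1,\infty]$ and $\mu\in\mathbb R$ let $L^p_\mu$ be the space of measurable $f:\mathbb R^k\to\mathbb C$ with $\|f\|_{L^p_\mu}=\|\,|\cdot|^{\mu}f\|_{L^p(\mathbb R^k)}<\infty$. Consider the form associated with the multilinear fractional integral $T_{N,\lambda}(f_1,\dots,f_N)(x)=\int_{\mathbb R^k}|y|^{-\lambda}\prod_{j=1}^N f_j(x-\theta_jy)\,dy$, namely the $(N+2)$-linear form $$\Lambda_N(f_0,\dots,f_N,f_{N+1})=\int_{\mathbb R^{2k}} f_{N+1}(y)\,f_0(x)\prod_{j=1}^N f_j(x-\theta_j y)\,dx\,dy .$$ Suppose that $$\frac{\lambda}{k}+\sum_{j=0}^N\Big(\frac1{p_j}+\frac{\lambda_j}{k}\Big)=2,\qquad 0<\frac{\lambda}{k}<1,\qquad \frac1{p_j}+\frac{\lambda_j}{k}<1\quad(j=0,\dots,N),$$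 $$\sum_{j=0}^N\frac1{p_j}\ge 1,\qquad \sum_{j=0}^N\lambda_j\ge 0,\qquad \lambda+\sum_{\substack{0\le j\le N\\ j\ne\ell}}\lambda_j>0\quad(\ell=0,\dots,N).$$ Then there is a finite constant $C$, depending only on $k$, $N$, $\lambda$ and the $\theta_j$, $p_j$, $\lambda_j$, such that for all $f_j\in L^{p_j}_{\lambda_j}$, $j=0,\dots,N$, the integral defining $\Lambda_N(f_0,\dots,f_N,|\cdot|^{-\lambda})$ converges absolutely and $$|\Lambda_N(f_0,\dots,f_N,|\cdot|^{-\lambda})|\le C\prod_{j=0}^N\|f_j\|_{L^{p_j}_{\lambda_j}} .$$ -/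

import Mathlib

open MeasureTheory
open scoped ENNReal

noncomputable section

/-- The norm of the power-weighted Lebesgue space: the `L^p` norm over `ℝ^k` of `|·|^w f`. -/
def weightedLpNorm {k : ℕ} (p : ℝ≥0∞) (w : ℝ) (f : EuclideanSpace ℝ (Fin k) → ℂ) : ℝ≥0∞ :=
  eLpNorm (fun x => (‖x‖ ^ w : ℝ) • f x) p volume

/-- Membership in the weighted space: `f` is measurable (up to null sets) and its norm is finite. -/
def MemWeightedLp {k : ℕ} (p : ℝ≥0∞) (w : ℝ) (f : EuclideanSpace ℝ (Fin k) → ℂ) : Prop :=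
  AEStronglyMeasurable f volume ∧ weightedLpNorm p w f < ∞

/-- The integrand `g(y) f_0(x) ∏_{j=1}^N f_j(x - θ_j y)` of the `(N+2)`-linear form, as a function
of `(x, y)`. The numbers `θ_1, …, θ_N` are indexed by `Fin N`, so `f_j` is `f j.succ` below. -/
def fracIntegrand {k N : ℕ} (θ : Fin N → ℝ) (f : Fin (N + 1) → EuclideanSpace ℝ (Fin k) → ℂ)
    (g : EuclideanSpace ℝ (Fin k) → ℂ)
    (z : EuclideanSpace ℝ (Fin k) × EuclideanSpace ℝ (Fin k)) : ℂ :=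
  g z.2 * f 0 z.1 * ∏ j : Fin N, f j.succ (z.1 - θ j • z.2)

/-- The `(N+2)`-linear form, with last argument `g`. -/
def fracForm {k N : ℕ} (θ : Fin N → ℝ) (f : Fin (N + 1) → EuclideanSpace ℝ (Fin k) → ℂ)
    (g : EuclideanSpace ℝ (Fin k) → ℂ) : ℂ :=
  ∫ z : EuclideanSpace ℝ (Fin k) × EuclideanSpace ℝ (Fin k), fracIntegrand θ f g z

/-- The kernel `|·|^{-lam}` of the fractional integral. -/
def powerKernel {k : ℕ} (lam : ℝ) (y : EuclideanSpace ℝ (Fin k)) : ℂ :=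
  ((‖y‖ ^ (-lam) : ℝ) : ℂ)

end

/-! Write ρ(x) = |x|^{-k}. For any positive M_j not below the norm of f_j, one has |f_j| ≤ M_j
|x|^{-λ_j} G_j^{1/p_j} almost everywhere, with G_j ≥ 0 and ∫ G_j ≤ 1. With θ_0 = 0 the arguments x -
θ_j y and y are N+2 linear forms on ℝ^{2k}, any two of which are coordinates. The integrand becomes
a product of powers of ρ and of the G_j at these forms, of total exponent 2, hence scale invariant.

Split ℝ^{2k} into finitely many regions by the smallest form l and the two largest values A ≥ B of
the densities. Two forms control all others, so the forms other than l have comparable size, and the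
integrand is at most a constant times A^u B^{V-u} K^m L^n. Here V = ∑ 1/p_j, u is the exponent of A,
L is ρ at form l and K is ρ at a reference form. After taking logarithms, convexity bounds this
monomial by AB plus terms A K^s L^{1-s} and B K^t L^{1-t} (`mul_rpow_le_of_ne`,
`exists_mul_rpow_le_of_eq`). Each term has a uniformly bounded integral by Tonelli in two forms: the
scale-invariant power, integrated over one form, is a constant. The strict inequalities among the
hypotheses put s and t in the ranges where this integral converges.

The exception is ∑ λ_j = 0 with y the smallest form. Then m = s = 0 and the integral diverges
logarithmically; the cut is made at ρ = A instead, as for Hardy–Littlewood–Sobolev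
(`mul_rpow_le_hardyLittlewoodSobolev`). -/

/-! ### Scaling and truncated integrals of |x|^{-d}. -/

section RieszDensity

open Module

variable {E : Type*} [NormedAddCommGroup E] [NormedSpace ℝ E]

/-- The function `‖x‖ ^ (-d)`, where `d` is the dimension of the space. -/
noncomputable def rieszDensity (x : E) : ℝ := ‖x‖ ^ (-(finrank ℝ E : ℝ))

lemma rieszDensity_pos {x : E} (hx : x ≠ 0) : 0 < rieszDensity x :=
  Real.rpow_pos_of_pos (norm_pos_iff.2 hx) _

lemma rieszDensity_nonneg (x : E) : 0 ≤ rieszDensity x := Real.rpow_nonneg (norm_nonneg _) _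

lemma rieszDensity_rpow (x : E) (s : ℝ) :
    rieszDensity x ^ s = ‖x‖ ^ (-(finrank ℝ E * s)) := by
  rw [rieszDensity, ← Real.rpow_mul (norm_nonneg _), neg_mul]

lemma rieszDensity_le {x y : E} (hx : x ≠ 0) (h : ‖x‖ ≤ ‖y‖) :
    rieszDensity y ≤ rieszDensity x :=
  Real.rpow_le_rpow_of_nonpos (norm_pos_iff.2 hx) h (by simp)

@[fun_prop]
lemma measurable_rieszDensity [MeasurableSpace E] [OpensMeasurableSpace E] :
    Measurable (rieszDensity : E → ℝ) := by
  unfold rieszDensity; fun_prop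

variable [FiniteDimensional ℝ E] [MeasureSpace E] [BorelSpace E]
  [(volume : Measure E).IsAddHaarMeasure]

/-- Dilating by t^{1/d} divides both the density and Lebesgue measure by t; all later power counting
rests on this. -/
lemma lintegral_comp_rieszDensity_mul (hd : 1 ≤ finrank ℝ E) {F : ℝ → ℝ≥0∞} (hF : Measurable F)
    {t : ℝ} (ht : 0 < t) :
    ∫⁻ x : E, F (t⁻¹ * rieszDensity x)
      = ENNReal.ofReal t⁻¹ * ∫⁻ x : E, F (rieszDensity x) := by
  have hd' : (0 : ℝ) < finrank ℝ E := by exact_mod_cast hd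
  set r : ℝ := t ^ (1 / (finrank ℝ E : ℝ)) with hr
  have hr0 : 0 < r := Real.rpow_pos_of_pos ht _
  have hrd : r ^ (finrank ℝ E : ℝ) = t := by
    rw [hr, ← Real.rpow_mul ht.le, one_div, inv_mul_cancel₀ hd'.ne', Real.rpow_one]
  have h1 : ∀ x : E, t⁻¹ * rieszDensity x = rieszDensity (r • x) := fun x ↦ by
    rw [rieszDensity, rieszDensity, norm_smul, Real.norm_of_nonneg hr0.le,
      Real.mul_rpow hr0.le (norm_nonneg _), Real.rpow_neg hr0.le, hrd]
  simp_rw [h1]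
  rw [← lintegral_map (f := fun y : E ↦ F (rieszDensity y)) (by fun_prop)
    (measurable_const_smul r), Measure.map_addHaar_smul _ hr0.ne', lintegral_smul_measure,
    smul_eq_mul]
  rw [← Real.rpow_natCast, hrd, abs_of_pos (inv_pos.2 ht)]

/-- The domain is a ball about the origin, where the power is integrable because s < 1. Scaling
reduces to t = 1. -/
lemma exists_lintegral_rieszDensity_ge_le (hd : 1 ≤ finrank ℝ E) {s : ℝ} (hs : s < 1) :
    ∃ C : ℝ, 0 ≤ C ∧ ∀ t : ℝ, 0 < t →
      ∫⁻ x : E, ENNReal.ofReal (if t ≤ rieszDensity x then rieszDensity x ^ s else 0)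
        ≤ ENNReal.ofReal (C * t ^ (s - 1)) := by
  have hd' : (0 : ℝ) < finrank ℝ E := by exact_mod_cast hd
  set F : ℝ → ℝ≥0∞ := fun u ↦ ENNReal.ofReal (if 1 ≤ u then u ^ s else 0) with hFdef
  have hF : Measurable F :=
    (Measurable.ite measurableSet_Ici (by fun_prop) (by fun_prop)).ennreal_ofReal
  have hfin : ∫⁻ x : E, F (rieszDensity x) ≠ ∞ := by
    have h1 : IntegrableOn (fun x : E ↦ rieszDensity x ^ s) (Metric.ball 0 2) := by
      refine integrableOn_ball_of_norm_le_rpow hd (C := 1) (α := finrank ℝ E * s) (by nlinarith)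
        (Filter.Eventually.of_forall fun x ↦ ?_)
        (measurable_rieszDensity.pow_const s).aestronglyMeasurable
      rw [rieszDensity_rpow, Real.norm_of_nonneg (Real.rpow_nonneg (norm_nonneg _) _), one_mul]
    have h2 := h1.setLIntegral_lt_top
    refine ne_top_of_le_ne_top h2.ne ?_
    rw [← lintegral_indicator Metric.isOpen_ball.measurableSet]
    refine lintegral_mono fun x ↦ ?_
    by_cases hx : 1 ≤ rieszDensity x
    · have : x ∈ Metric.ball (0 : E) 2 := by
        rw [mem_ball_zero_iff]
        by_contra! h
        have : rieszDensity x < 1 := Real.rpow_lt_one_of_one_lt_of_neg (by linarith) (by linarith)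
        linarith
      simp [hFdef, hx, this]
    · simp [hFdef, hx]
  refine ⟨(∫⁻ x : E, F (rieszDensity x)).toReal, ENNReal.toReal_nonneg, fun t ht ↦ ?_⟩
  have key : ∀ x : E, ENNReal.ofReal (if t ≤ rieszDensity x then rieszDensity x ^ s else 0)
      = ENNReal.ofReal (t ^ s) * F (t⁻¹ * rieszDensity x) := fun x ↦ by
    rw [hFdef, ← ENNReal.ofReal_mul (by positivity)]
    congr 1
    have : 1 ≤ t⁻¹ * rieszDensity x ↔ t ≤ rieszDensity x := by
      rw [inv_mul_eq_div, one_le_div ht]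
    simp only [this]
    split_ifs
    · rw [← Real.mul_rpow ht.le (mul_nonneg (by positivity) (rieszDensity_nonneg _)),
        mul_inv_cancel_left₀ ht.ne']
    · simp
  simp_rw [key]
  rw [lintegral_const_mul _ (by fun_prop), lintegral_comp_rieszDensity_mul hd hF ht, ← mul_assoc,
    ← ENNReal.ofReal_mul (by positivity), mul_comm,
    ENNReal.ofReal_mul ENNReal.toReal_nonneg, ENNReal.ofReal_toReal hfin, Real.rpow_sub_one ht.ne',
    div_eq_mul_inv]

/-- Here the domain is the outside of a ball, and s > 1 gives convergence at infinity. -/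
lemma exists_lintegral_rieszDensity_le_le (hd : 1 ≤ finrank ℝ E) {s : ℝ} (hs : 1 < s) :
    ∃ C : ℝ, 0 ≤ C ∧ ∀ t : ℝ, 0 < t →
      ∫⁻ x : E, ENNReal.ofReal (if rieszDensity x ≤ t then rieszDensity x ^ s else 0)
        ≤ ENNReal.ofReal (C * t ^ (s - 1)) := by
  have hd' : (0 : ℝ) < finrank ℝ E := by exact_mod_cast hd
  set F : ℝ → ℝ≥0∞ := fun u ↦ ENNReal.ofReal (if u ≤ 1 then u ^ s else 0) with hFdef
  have hF : Measurable F :=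
    (Measurable.ite measurableSet_Iic (by fun_prop) (by fun_prop)).ennreal_ofReal
  have hfin : ∫⁻ x : E, F (rieszDensity x) ≠ ∞ := by
    have h1 := finite_integral_one_add_norm (μ := (volume : Measure E)) (r := finrank ℝ E * s)
      (by nlinarith)
    have h2 : ENNReal.ofReal (2 ^ (finrank ℝ E * s)) *
        ∫⁻ x : E, ENNReal.ofReal ((1 + ‖x‖) ^ (-(finrank ℝ E * s))) ≠ ∞ :=
      ENNReal.mul_ne_top ENNReal.ofReal_ne_top h1.ne
    refine ne_top_of_le_ne_top h2 ?_
    rw [← lintegral_const_mul _ (by fun_prop)]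
    refine lintegral_mono fun x ↦ ?_
    rw [← ENNReal.ofReal_mul (by positivity)]
    refine ENNReal.ofReal_le_ofReal ?_
    split_ifs with hx
    -- By the convention for real powers of 0, the density vanishes at the origin, so the origin
    -- belongs to the sublevel set.
    · rcases eq_or_ne x 0 with rfl | hx0
      · rw [rieszDensity_rpow, norm_zero, Real.zero_rpow (by nlinarith)]
        positivity
      have hn : 0 < ‖x‖ := norm_pos_iff.2 hx0
      have : 1 ≤ ‖x‖ := by
        by_contra! h
        have : 1 < rieszDensity x := Real.one_lt_rpow_of_pos_of_lt_one_of_neg hn h (by linarith)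
        linarith
      rw [rieszDensity_rpow, Real.rpow_neg hn.le, Real.rpow_neg (by positivity),
        ← div_eq_mul_inv, ← Real.div_rpow (by norm_num) (by positivity),
        ← Real.inv_rpow hn.le]
      refine Real.rpow_le_rpow (by positivity) ?_ (by nlinarith)
      rw [inv_eq_one_div, div_le_div_iff₀ hn (by positivity)]
      linarith
    · positivity
  refine ⟨(∫⁻ x : E, F (rieszDensity x)).toReal, ENNReal.toReal_nonneg, fun t ht ↦ ?_⟩
  have key : ∀ x : E, ENNReal.ofReal (if rieszDensity x ≤ t then rieszDensity x ^ s else 0)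
      = ENNReal.ofReal (t ^ s) * F (t⁻¹ * rieszDensity x) := fun x ↦ by
    rw [hFdef, ← ENNReal.ofReal_mul (by positivity)]
    congr 1
    have : t⁻¹ * rieszDensity x ≤ 1 ↔ rieszDensity x ≤ t := by
      rw [inv_mul_eq_div, div_le_one ht]
    simp only [this]
    split_ifs
    · rw [← Real.mul_rpow ht.le (mul_nonneg (by positivity) (rieszDensity_nonneg _)),
        mul_inv_cancel_left₀ ht.ne']
    · simp
  simp_rw [key]
  rw [lintegral_const_mul _ (by fun_prop), lintegral_comp_rieszDensity_mul hd hF ht, ← mul_assoc,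
    ← ENNReal.ofReal_mul (by positivity), mul_comm,
    ENNReal.ofReal_mul ENNReal.toReal_nonneg, ENNReal.ofReal_toReal hfin, Real.rpow_sub_one ht.ne',
    div_eq_mul_inv]

end RieszDensity

/-! ### The linear forms x - θ_j y and y, and changes of variables to pairs of them. -/

section LinearForms

open Module

variable {E : Type*} [NormedAddCommGroup E] [NormedSpace ℝ E] {ι : Type*}

/-- The linear forms `x - θ j • y` (for `some j`) and `y` (for `none`) in `z = (x, y)`. -/
def shiftForm (θ : ι → ℝ) (o : Option ι) : E × E →ₗ[ℝ] E :=
  o.elim (LinearMap.snd ℝ E E) fun j ↦ LinearMap.fst ℝ E E - θ j • LinearMap.snd ℝ E E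

@[simp] lemma shiftForm_none (θ : ι → ℝ) (z : E × E) : shiftForm θ none z = z.2 := rfl

@[simp] lemma shiftForm_some (θ : ι → ℝ) (j : ι) (z : E × E) :
    shiftForm θ (some j) z = z.1 - θ j • z.2 := rfl

/-- Any two of the forms control both coordinates. -/
lemma exists_norm_le_shiftForm_add {θ : ι → ℝ} (hθ : Function.Injective θ) {o o' : Option ι}
    (h : o ≠ o') (i : Option ι) :
    ∃ D : ℝ, 1 ≤ D ∧ ∀ z : E × E,
      ‖shiftForm θ i z‖ ≤ D * (‖shiftForm θ o z‖ + ‖shiftForm θ o' z‖) := by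
  suffices H : ∃ D : ℝ, 0 ≤ D ∧ ∀ z : E × E, ‖z.1‖ ≤ D * (‖shiftForm θ o z‖ + ‖shiftForm θ o' z‖) ∧
      ‖z.2‖ ≤ D * (‖shiftForm θ o z‖ + ‖shiftForm θ o' z‖) by
    obtain ⟨D, hD, H⟩ := H
    set c : ℝ := i.elim 0 fun j ↦ |θ j|
    have hc : 0 ≤ c := by
      cases i <;> simp [c]
    -- D + cD bounds |x| + c|y|; the extra 1 secures the lower bound on the constant.
    refine ⟨D + c * D + 1, by nlinarith [mul_nonneg hc hD], fun z ↦ ?_⟩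
    have h0 : 0 ≤ ‖shiftForm θ o z‖ + ‖shiftForm θ o' z‖ := by positivity
    obtain ⟨h1, h2⟩ := H z
    have h3 : ‖shiftForm θ i z‖ ≤ ‖z.1‖ + ‖z.2‖ * c ∨ ‖shiftForm θ i z‖ ≤ ‖z.2‖ := by
      cases i with
      | none => right; simp
      | some j =>
        left
        refine (norm_sub_le _ _).trans ?_
        rw [LinearMap.smul_apply, norm_smul, Real.norm_eq_abs, mul_comm]
        rfl
    have h4 := mul_le_mul_of_nonneg_right h2 hc
    rcases h3 with h3 | h3 <;> nlinarith [mul_nonneg (mul_nonneg hD hc) h0, mul_nonneg hD h0]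
  have hsome : ∀ j : ι, ∀ z : E × E,
      ‖z.1‖ ≤ (1 + |θ j|) * (‖shiftForm θ (some j) z‖ + ‖z.2‖) := fun j z ↦ by
    have : z.1 = shiftForm θ (some j) z + θ j • z.2 := by simp
    have h1 : ‖z.1‖ ≤ ‖shiftForm θ (some j) z‖ + |θ j| * ‖z.2‖ := by
      conv_lhs => rw [this]
      refine (norm_add_le _ _).trans ?_
      rw [norm_smul, Real.norm_eq_abs]
    nlinarith [abs_nonneg (θ j), norm_nonneg (shiftForm θ (some j) z), norm_nonneg z.2,
      mul_nonneg (abs_nonneg (θ j)) (norm_nonneg (shiftForm θ (some j) z))]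
  cases o with
  | none =>
    cases o' with
    | none => exact absurd rfl h
    | some j =>
      refine ⟨1 + |θ j|, by positivity, fun z ↦ ⟨by simpa [add_comm] using hsome j z, ?_⟩⟩
      simp only [shiftForm_none]
      nlinarith [abs_nonneg (θ j), norm_nonneg (shiftForm θ (some j) z), norm_nonneg z.2,
        mul_nonneg (abs_nonneg (θ j)) (norm_nonneg (shiftForm θ (some j) z)),
        mul_nonneg (abs_nonneg (θ j)) (norm_nonneg z.2)]
  | some j =>
    cases o' with
    | none =>
      refine ⟨1 + |θ j|, by positivity, fun z ↦ ⟨by simpa using hsome j z, ?_⟩⟩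
      simp only [shiftForm_none]
      nlinarith [abs_nonneg (θ j), norm_nonneg (shiftForm θ (some j) z), norm_nonneg z.2,
        mul_nonneg (abs_nonneg (θ j)) (norm_nonneg (shiftForm θ (some j) z)),
        mul_nonneg (abs_nonneg (θ j)) (norm_nonneg z.2)]
    | some l =>
      have hne : θ l - θ j ≠ 0 := sub_ne_zero.2 fun he ↦ h (by rw [hθ he])
      set b : ℝ := |(θ l - θ j)⁻¹|
      have hb : 0 ≤ b := abs_nonneg _
      have h2 : ∀ z : E × E,
          ‖z.2‖ ≤ b * (‖shiftForm θ (some j) z‖ + ‖shiftForm θ (some l) z‖) := fun z ↦ by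
        have : z.2 = (θ l - θ j)⁻¹ • (shiftForm θ (some j) z - shiftForm θ (some l) z) := by
          have : shiftForm θ (some j) z - shiftForm θ (some l) z = (θ l - θ j) • z.2 := by
            simp only [shiftForm_some]; module
          rw [this, inv_smul_smul₀ hne]
        conv_lhs => rw [this, norm_smul]
        exact mul_le_mul_of_nonneg_left (norm_sub_le _ _) hb
      refine ⟨(1 + |θ j|) * (1 + b), by positivity, fun z ↦ ?_⟩
      have h1 := hsome j z
      have h2' := h2 z
      have hj := abs_nonneg (θ j)
      have h3 := norm_nonneg (shiftForm θ (some j) z)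
      have h4 := norm_nonneg (shiftForm θ (some l) z)
      constructor
      · refine h1.trans ?_
        rw [mul_assoc]
        refine mul_le_mul_of_nonneg_left ?_ (by positivity)
        linarith
      · refine h2'.trans (mul_le_mul_of_nonneg_right ?_ (by positivity))
        nlinarith [mul_nonneg hj hb]

lemma shiftForm_prod_injective {θ : ι → ℝ} (hθ : Function.Injective θ) {o o' : Option ι}
    (h : o ≠ o') :
    Function.Injective ((shiftForm (E := E) θ o).prod (shiftForm θ o')) := by
  rw [← LinearMap.ker_eq_bot, LinearMap.ker_eq_bot']
  intro z hz
  have h1 : shiftForm θ o z = 0 := congrArg Prod.fst hz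
  have h2 : shiftForm θ o' z = 0 := congrArg Prod.snd hz
  by_cases hn : Nonempty ι
  · obtain ⟨i⟩ := hn
    obtain ⟨D, -, hD⟩ := exists_norm_le_shiftForm_add (E := E) hθ h none
    obtain ⟨D', -, hD'⟩ := exists_norm_le_shiftForm_add (E := E) hθ h (some i)
    have h3 : z.2 = 0 := by simpa [h1, h2] using hD z
    have h4 := hD' z
    rw [shiftForm_some, h3] at h4
    exact Prod.ext (by simpa [h1, h2] using h4) h3
  · rw [not_nonempty_iff] at hn
    exact absurd (Subsingleton.elim o o') h

@[fun_prop]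
lemma measurable_shiftForm [FiniteDimensional ℝ E] [MeasurableSpace E] [BorelSpace E] (θ : ι → ℝ) (o : Option ι) :
    Measurable (fun z : E × E ↦ shiftForm θ o z) :=
  (LinearMap.continuous_of_finiteDimensional _).measurable

variable [FiniteDimensional ℝ E] [MeasureSpace E] [BorelSpace E]
  [(volume : Measure E).IsAddHaarMeasure]

/-- Two distinct forms give a linear automorphism of E × E, and c is the absolute value of its
inverse determinant. -/
lemma exists_map_shiftForm_prod {θ : ι → ℝ} (hθ : Function.Injective θ) {o o' : Option ι}
    (h : o ≠ o') :
    ∃ c : ℝ, 0 ≤ c ∧ (volume : Measure (E × E)).map (fun z ↦ (shiftForm θ o z, shiftForm θ o' z))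
      = ENNReal.ofReal c • (volume : Measure (E × E)) := by
  set L : E × E →ₗ[ℝ] E × E := (shiftForm θ o).prod (shiftForm θ o')
  have hdet : LinearMap.det L ≠ 0 :=
    (LinearEquiv.isUnit_det' (LinearEquiv.ofInjectiveEndo L (shiftForm_prod_injective hθ h))).ne_zero
  have : (volume : Measure (E × E)).IsAddHaarMeasure :=
    inferInstanceAs ((volume : Measure E).prod (volume : Measure E)).IsAddHaarMeasure
  exact ⟨_, abs_nonneg _, Measure.map_linearMap_addHaar_eq_smul_addHaar volume hdet⟩

lemma exists_lintegral_shiftForm_eq {θ : ι → ℝ} (hθ : Function.Injective θ) {o o' : Option ι}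
    (h : o ≠ o') :
    ∃ c : ℝ, 0 ≤ c ∧ ∀ H : E × E → ℝ≥0∞, Measurable H →
      ∫⁻ z : E × E, H (shiftForm θ o z, shiftForm θ o' z)
        = ENNReal.ofReal c * ∫⁻ x : E, ∫⁻ y : E, H (x, y) := by
  obtain ⟨c, hc, hmap⟩ := exists_map_shiftForm_prod (E := E) hθ h
  refine ⟨c, hc, fun H hH ↦ ?_⟩
  rw [← lintegral_map (f := H) hH (by fun_prop), hmap, lintegral_smul_measure, smul_eq_mul,
    Measure.volume_eq_prod, lintegral_prod _ hH.aemeasurable]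

/-- A second form completes the given one to a coordinate system, so preimages of null sets are
null. -/
lemma quasiMeasurePreserving_shiftForm {θ : ι → ℝ} (hθ : Function.Injective θ) [Nonempty ι]
    (o : Option ι) :
    Measure.QuasiMeasurePreserving (fun z : E × E ↦ shiftForm θ o z) := by
  obtain ⟨o', h⟩ := exists_ne o
  obtain ⟨c, hc, hmap⟩ := exists_map_shiftForm_prod (E := E) hθ h.symm
  have h1 : Measure.QuasiMeasurePreserving
      (fun z : E × E ↦ (shiftForm θ o z, shiftForm θ o' z)) :=
    ⟨by fun_prop, hmap ▸ Measure.smul_absolutelyContinuous⟩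
  exact (Measure.quasiMeasurePreserving_fst (μ := (volume : Measure E))
    (ν := (volume : Measure E))).comp h1

end LinearForms

/-! ### Pointwise inequalities between monomials. -/

section PointwiseBounds

open Real

lemma prod_rpow_le_of_isMax {ι : Type*} [Fintype ι] [DecidableEq ι] {G v : ι → ℝ} {a b : ι}
    (hG : ∀ j, 0 ≤ G j) (hv : ∀ j, 0 ≤ v j) (hb : ∀ j, j ≠ a → G j ≤ G b) :
    ∏ j, G j ^ v j ≤ G a ^ v a * G b ^ (∑ j, v j - v a) := by
  rw [← Finset.mul_prod_erase _ _ (Finset.mem_univ a),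
    ← Finset.add_sum_erase _ _ (Finset.mem_univ a), add_sub_cancel_left,
    rpow_sum_of_nonneg (hG b) fun j _ ↦ hv j]
  refine mul_le_mul_of_nonneg_left ?_ (rpow_nonneg (hG a) _)
  exact Finset.prod_le_prod (fun j _ ↦ rpow_nonneg (hG j) _) fun j hj ↦
    rpow_le_rpow (hG j) (hb j (Finset.ne_of_mem_erase hj)) (hv j)

lemma rpow_le_of_comparable {s t D : ℝ} (hs : 0 < s) (ht : 0 < t) (hD : 0 < D)
    (hst : s ≤ D * t) (hts : t ≤ D * s) (r : ℝ) : s ^ r ≤ D ^ |r| * t ^ r := by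
  rcases le_or_gt 0 r with hr | hr
  · rw [abs_of_nonneg hr, ← mul_rpow hD.le ht.le]
    exact rpow_le_rpow hs.le hst hr
  · rw [abs_of_neg hr, rpow_neg hD.le, ← inv_rpow hD.le, ← mul_rpow (inv_nonneg.2 hD.le) ht.le]
    refine rpow_le_rpow_of_nonpos (by positivity) ?_ hr.le
    rwa [inv_mul_le_iff₀ hD]

/-- The two largest values enter with exponents `u` and `V - u`. The first of them is not attached
to the singular form. -/
lemma mul_rpow_le_of_ne {A B K L u V m n : ℝ} (hB : 0 ≤ B) (hBA : B ≤ A) (hK : 0 < K) (hL : 0 < L)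
    (hu : u ≤ 1) (huV : u < V) (hV1 : 1 ≤ V) (hV2 : V < 2) (hmn : m + n = 2 - V) :
    A ^ u * B ^ (V - u) * (K ^ m * L ^ n)
      ≤ A * B + A * (K ^ (m / (2 - V)) * L ^ (1 - m / (2 - V))) := by
  have hV2' : 0 < 2 - V := sub_pos.2 hV2
  rcases hB.eq_or_lt with rfl | hB
  · rw [zero_rpow (sub_pos.2 huV).ne']
    simp only [mul_zero, zero_mul, zero_add]
    positivity
  have hA : 0 < A := hB.trans_le hBA
  set s := m / (2 - V)
  have hs : (2 - V) * s = m := mul_div_cancel₀ _ hV2'.ne'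
  obtain ⟨a, rfl⟩ : ∃ a, exp a = A := ⟨log A, exp_log hA⟩
  obtain ⟨b, rfl⟩ : ∃ b, exp b = B := ⟨log B, exp_log hB⟩
  obtain ⟨k, rfl⟩ : ∃ k, exp k = K := ⟨log K, exp_log hK⟩
  obtain ⟨l, rfl⟩ : ∃ l, exp l = L := ⟨log L, exp_log hL⟩
  rw [exp_le_exp] at hBA
  simp only [← exp_mul, ← exp_add]
  have hn : n = (2 - V) * (1 - s) := by linarith
  -- In logarithms, the left side lies below the convex combination, with weights 2 - V and V - 1,
  -- of the two terms on the right; the gap is (a - b)(1 - u).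
  have key : a * u + b * (V - u) + (k * m + l * n)
      ≤ (2 - V) * (a + (k * s + l * (1 - s))) + (V - 1) * (a + b) := by
    have : 0 ≤ (a - b) * (1 - u) := mul_nonneg (sub_nonneg.2 hBA) (sub_nonneg.2 hu)
    rw [hn, ← hs]
    linarith
  rcases le_total (a + b) (a + (k * s + l * (1 - s))) with h | h
  · refine le_add_of_nonneg_of_le (exp_pos _).le (exp_le_exp.2 (key.trans ?_))
    nlinarith
  · refine le_add_of_le_of_nonneg (exp_le_exp.2 (key.trans ?_)) (exp_pos _).le
    nlinarith

/-- The largest value is attached to the singular form. -/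
lemma exists_mul_rpow_le_of_eq {u V m n : ℝ} (hu0 : 0 ≤ u) (hu : u < 1) (hV1 : 1 ≤ V)
    (hV2 : V < 2) (hmn : m + n = 2 - V) (hm : 0 < m) (hun : u + n < 1) :
    ∃ s t : ℝ, 1 < s ∧ 0 < t ∧ ∀ A B K L : ℝ, 0 ≤ B → B ≤ A → 0 < K → 0 < L →
      A ^ u * B ^ (V - u) * (K ^ m * L ^ n)
        ≤ A * B + A * (K ^ s * L ^ (1 - s)) + B * (K ^ t * L ^ (1 - t)) := by
  -- The three terms get weights V - 1, α, β with sum 1, so A has total exponent u'. Raising u to u'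
  -- only enlarges the monomial since B ≤ A, and u' ≥ V - 1 makes α ≥ 0.
  set u' := max u (V - 1)
  have h1 : u ≤ u' := le_max_left _ _
  have h2 : V - 1 ≤ u' := le_max_right _ _
  have h3 : u' < 1 := max_lt hu (by linarith)
  set α := u' + 1 - V with hα
  have hα0 : 0 ≤ α := by linarith
  have hα1 : α < 1 := by linarith
  have hαm : α < m := by
    rcases max_choice u (V - 1) with h | h <;> simp only [hα, u', h] <;> linarith
  set β := 1 - u' with hβ
  have hβ0 : 0 < β := by linarith
  -- Matching the exponent of K requires αs + βt = m. As α < m, a value of s slightly above 1 leaves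
  -- t > 0.
  set s := 1 + (m - α) / 2 with hs
  have hs1 : 1 < s := by linarith
  set t := (m - α * s) / β
  have ht0 : 0 < t := by
    refine div_pos ?_ hβ0
    nlinarith
  have ht : β * t = m - α * s := mul_div_cancel₀ _ hβ0.ne'
  have hn : n = α * (1 - s) + β * (1 - t) := by linarith
  refine ⟨s, t, hs1, ht0, fun A B K L hB hBA hK hL ↦ ?_⟩
  rcases hB.eq_or_lt with rfl | hB
  · rw [zero_rpow (by linarith)]
    simp only [mul_zero, zero_mul, zero_add, add_zero]
    positivity
  have hA : 0 < A := hB.trans_le hBA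
  obtain ⟨a, rfl⟩ : ∃ a, exp a = A := ⟨log A, exp_log hA⟩
  obtain ⟨b, rfl⟩ : ∃ b, exp b = B := ⟨log B, exp_log hB⟩
  obtain ⟨k, rfl⟩ : ∃ k, exp k = K := ⟨log K, exp_log hK⟩
  obtain ⟨l, rfl⟩ : ∃ l, exp l = L := ⟨log L, exp_log hL⟩
  rw [exp_le_exp] at hBA
  simp only [← exp_mul, ← exp_add]
  set X := a + b
  set Y := a + (k * s + l * (1 - s)) with hY
  set Z := b + (k * t + l * (1 - t)) with hZ
  have key : a * u + b * (V - u) + (k * m + l * n) ≤ (V - 1) * X + α * Y + β * Z := by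
    have h5 : 0 ≤ (a - b) * (u' - u) := mul_nonneg (sub_nonneg.2 hBA) (sub_nonneg.2 h1)
    have h6 : (V - 1) * X + α * Y + β * Z - (a * u + b * (V - u) + (k * m + l * n))
        = (a - b) * (u' - u) := by
      rw [hn, hY, hZ]
      linear_combination k * ht
    linarith
  have key2 : a * u + b * (V - u) + (k * m + l * n) ≤ max (max X Y) Z := by
    have hX : X ≤ max (max X Y) Z := (le_max_left _ _).trans (le_max_left _ _)
    have hY' : Y ≤ max (max X Y) Z := (le_max_right _ _).trans (le_max_left _ _)
    have hZ' : Z ≤ max (max X Y) Z := le_max_right _ _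
    have e1 := mul_le_mul_of_nonneg_left hX (sub_nonneg.2 hV1)
    have e2 := mul_le_mul_of_nonneg_left hY' hα0
    have e3 := mul_le_mul_of_nonneg_left hZ' hβ0.le
    have e4 : (V - 1) + α + β = 1 := by linarith
    calc _ ≤ (V - 1) * X + α * Y + β * Z := key
      _ ≤ ((V - 1) + α + β) * max (max X Y) Z := by linarith
      _ = _ := by rw [e4, one_mul]
  have hX := exp_pos X
  have hY' := exp_pos Y
  have hZ' := exp_pos Z
  refine (exp_le_exp.2 key2).trans ?_
  rcases max_choice (max X Y) Z with h | h
  · rw [h]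
    rcases max_choice X Y with h | h <;> rw [h] <;> linarith
  · rw [h]; linarith

/-- The pointwise bound behind the Hardy–Littlewood–Sobolev inequality. -/
lemma mul_rpow_le_hardyLittlewoodSobolev {A B K u V : ℝ} (hB : 0 ≤ B) (hBA : B ≤ A) (hK : 0 < K)
    (hu0 : 0 ≤ u) (hu : u ≤ 1) (huV : u < V) (hV2 : V ≤ 2) :
    A ^ u * B ^ (V - u) * K ^ (2 - V)
      ≤ A * B + A ^ u * (if K ≤ A then K ^ (2 - u) else 0)
        + A ^ V * (if A ≤ K then K ^ (2 - V) else 0) := by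
  have hA : 0 ≤ A := hB.trans hBA
  have p1 : 0 ≤ A * B := by positivity
  have p2 : 0 ≤ A ^ u * (if K ≤ A then K ^ (2 - u) else 0) := by
    split_ifs <;> positivity
  have p3 : 0 ≤ A ^ V * (if A ≤ K then K ^ (2 - V) else 0) := by
    split_ifs <;> positivity
  rcases le_total A K with h | h
  · have : A ^ u * B ^ (V - u) * K ^ (2 - V) ≤ A ^ V * K ^ (2 - V) := by
      refine mul_le_mul_of_nonneg_right ?_ (by positivity)
      calc A ^ u * B ^ (V - u) ≤ A ^ u * A ^ (V - u) :=
            mul_le_mul_of_nonneg_left (rpow_le_rpow hB hBA (by linarith)) (by positivity)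
        _ = A ^ V := by
            rw [← rpow_add_of_nonneg hA hu0 (by linarith), add_sub_cancel]
    rw [if_pos h] at p3 ⊢
    linarith
  rcases le_total B K with h' | h'
  · have : A ^ u * B ^ (V - u) * K ^ (2 - V) ≤ A ^ u * K ^ (2 - u) := by
      rw [mul_assoc]
      refine mul_le_mul_of_nonneg_left ?_ (by positivity)
      calc B ^ (V - u) * K ^ (2 - V) ≤ K ^ (V - u) * K ^ (2 - V) :=
            mul_le_mul_of_nonneg_right (rpow_le_rpow hB h' (by linarith)) (by positivity)
        _ = K ^ (2 - u) := by rw [← rpow_add hK]; congr 1; ring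
    rw [if_pos h] at p2 ⊢
    linarith
  · have hB' : 0 < B := hK.trans_le h'
    have hA' : 0 < A := hB'.trans_le hBA
    have : A ^ u * B ^ (V - u) * K ^ (2 - V) ≤ A * B := by
      calc A ^ u * B ^ (V - u) * K ^ (2 - V) ≤ A ^ u * B ^ (V - u) * B ^ (2 - V) :=
            mul_le_mul_of_nonneg_left (rpow_le_rpow hK.le h' (by linarith)) (by positivity)
        _ = A ^ u * B ^ (1 - u) * B := by
            rw [mul_assoc, mul_assoc, ← rpow_add hB']
            nth_rewrite 3 [← rpow_one B]
            rw [← rpow_add hB']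
            congr 2; ring
        _ ≤ A ^ u * A ^ (1 - u) * B :=
            mul_le_mul_of_nonneg_right (mul_le_mul_of_nonneg_left
              (rpow_le_rpow hB hBA (by linarith)) (by positivity)) hB
        _ = A * B := by rw [← rpow_add hA', add_sub_cancel, rpow_one]
    linarith

end PointwiseBounds

/-! ### Comparability of all forms but the smallest. -/

section Comparison

variable {E : Type*} [NormedAddCommGroup E] [NormedSpace ℝ E] {ι : Type*}

/-- Away from the smallest form, all forms have comparable size. -/
lemma exists_rieszDensity_rpow_le {θ : ι → ℝ} (hθ : Function.Injective θ) {l i j : Option ι}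
    (hi : i ≠ l) (hj : j ≠ l) (r : ℝ) :
    ∃ C : ℝ, 0 ≤ C ∧ ∀ z : E × E, (∀ o, shiftForm θ o z ≠ 0) →
      (∀ o, ‖shiftForm θ l z‖ ≤ ‖shiftForm θ o z‖) →
      rieszDensity (shiftForm θ i z) ^ r ≤ C * rieszDensity (shiftForm θ j z) ^ r := by
  -- Forms j and l control form i, and form l is no larger than form j; hence form j alone controls
  -- form i, and symmetrically.
  obtain ⟨D₁, h₁, H₁⟩ := exists_norm_le_shiftForm_add (E := E) hθ hj i
  obtain ⟨D₂, h₂, H₂⟩ := exists_norm_le_shiftForm_add (E := E) hθ hi j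
  have hD : 0 < 2 * (D₁ + D₂) := by linarith
  refine ⟨_, Real.rpow_nonneg hD.le |-(Module.finrank ℝ E * r)|, fun z hz hl ↦ ?_⟩
  rw [rieszDensity_rpow, rieszDensity_rpow]
  refine rpow_le_of_comparable (norm_pos_iff.2 (hz i)) (norm_pos_iff.2 (hz j)) hD ?_ ?_ _
  · nlinarith [H₁ z, hl j, norm_nonneg (shiftForm θ j z)]
  · nlinarith [H₂ z, hl i, norm_nonneg (shiftForm θ i z)]

/-- Collapses the weights at all forms onto two: the smallest, and one reference form standing for
the others. -/
lemma exists_prod_rieszDensity_rpow_le [Fintype ι] [DecidableEq ι] {θ : ι → ℝ}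
    (hθ : Function.Injective θ) {l j : Option ι} (hj : j ≠ l) (e : Option ι → ℝ) :
    ∃ C : ℝ, 0 ≤ C ∧ ∀ z : E × E, (∀ o, shiftForm θ o z ≠ 0) →
      (∀ o, ‖shiftForm θ l z‖ ≤ ‖shiftForm θ o z‖) →
      ∏ o, rieszDensity (shiftForm θ o z) ^ e o ≤
        C * (rieszDensity (shiftForm θ j z) ^ (∑ o, e o - e l) *
          rieszDensity (shiftForm θ l z) ^ e l) := by
  have : ∀ o, ∃ C : ℝ, 0 ≤ C ∧ (o ≠ l → ∀ z : E × E, (∀ o, shiftForm θ o z ≠ 0) →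
      (∀ o, ‖shiftForm θ l z‖ ≤ ‖shiftForm θ o z‖) →
      rieszDensity (shiftForm θ o z) ^ e o ≤ C * rieszDensity (shiftForm θ j z) ^ e o) := by
    intro o
    by_cases ho : o = l
    · exact ⟨0, le_rfl, fun h ↦ absurd ho h⟩
    · obtain ⟨C, hC, H⟩ := exists_rieszDensity_rpow_le (E := E) hθ ho hj (e o)
      exact ⟨C, hC, fun _ ↦ H⟩
  choose C hC H using this
  refine ⟨∏ o ∈ Finset.univ.erase l, C o, Finset.prod_nonneg fun o _ ↦ hC o, fun z hz hl ↦ ?_⟩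
  rw [← Finset.mul_prod_erase _ _ (Finset.mem_univ l),
    ← Finset.add_sum_erase _ e (Finset.mem_univ l), add_sub_cancel_left,
    Real.rpow_sum_of_pos (rieszDensity_pos (hz j)), mul_comm, ← mul_assoc,
    ← Finset.prod_mul_distrib]
  refine mul_le_mul_of_nonneg_right ?_ (Real.rpow_nonneg (rieszDensity_nonneg _) _)
  exact Finset.prod_le_prod (fun o _ ↦ Real.rpow_nonneg (rieszDensity_nonneg _) _)
    fun o ho ↦ H o (Finset.ne_of_mem_erase ho) z hz hl

end Comparison

/-! ### Bookkeeping for integrals of real functions. -/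

section LIntegralOfReal

variable {α : Type*} [MeasurableSpace α] {μ : Measure α}

lemma lintegral_ofReal_add_le_of_le {f g : α → ℝ} {c d : ℝ} (hf : Measurable f) (hc : 0 ≤ c)
    (hd : 0 ≤ d) (h₁ : ∫⁻ x, ENNReal.ofReal (f x) ∂μ ≤ ENNReal.ofReal c)
    (h₂ : ∫⁻ x, ENNReal.ofReal (g x) ∂μ ≤ ENNReal.ofReal d) :
    ∫⁻ x, ENNReal.ofReal (f x + g x) ∂μ ≤ ENNReal.ofReal (c + d) := by
  rw [ENNReal.ofReal_add hc hd]
  refine (lintegral_mono fun x ↦ ENNReal.ofReal_add_le).trans ?_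
  rw [lintegral_add_left hf.ennreal_ofReal]
  exact add_le_add h₁ h₂

lemma lintegral_ofReal_const_mul_le_of_le {f : α → ℝ} {b c : ℝ} (hb : 0 ≤ b)
    (h : ∫⁻ x, ENNReal.ofReal (f x) ∂μ ≤ ENNReal.ofReal c) :
    ∫⁻ x, ENNReal.ofReal (b * f x) ∂μ ≤ ENNReal.ofReal (b * c) := by
  simp_rw [ENNReal.ofReal_mul hb]
  rw [lintegral_const_mul' _ _ ENNReal.ofReal_ne_top]
  gcongr

end LIntegralOfReal

/-! ### Uniform integral bounds for the dominating terms. -/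

section TwoForms

open Module

variable {E : Type*} [NormedAddCommGroup E] [NormedSpace ℝ E] {ι : Type*}
  [FiniteDimensional ℝ E] [MeasureSpace E] [BorelSpace E]

/-- A nonnegative measurable function of integral at most one. -/
structure IsSubdensity (G : E → ℝ) : Prop where
  measurable : Measurable G
  nonneg : ∀ x, 0 ≤ G x
  lintegral_le : ∫⁻ x, ENNReal.ofReal (G x) ≤ 1

variable [(volume : Measure E).IsAddHaarMeasure]

/-- Common template: with the two forms as coordinates p and q, Tonelli integrates q first, and G
has total mass at most 1. The null point p = 0, where the density degenerates, is excluded. -/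
lemma exists_lintegral_shiftForm_le (hd : 1 ≤ finrank ℝ E) {θ : ι → ℝ}
    (hθ : Function.Injective θ) {o o' : Option ι} (h : o ≠ o') :
    ∃ c : ℝ, 0 ≤ c ∧ ∀ (C : ℝ) (G : E → ℝ) (H : E → E → ℝ), 0 ≤ C → IsSubdensity G →
      Measurable (Function.uncurry H) →
      (∀ p, p ≠ 0 → ∫⁻ q, ENNReal.ofReal (H p q) ≤ ENNReal.ofReal (C * G p)) →
      ∫⁻ z : E × E, ENNReal.ofReal (H (shiftForm θ o z) (shiftForm θ o' z))
        ≤ ENNReal.ofReal (c * C) := by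
  have : Nontrivial E := Module.nontrivial_of_finrank_pos (R := ℝ) hd
  obtain ⟨c, hc, key⟩ := exists_lintegral_shiftForm_eq (E := E) hθ h
  refine ⟨c, hc, fun C G H hC hG hH hint ↦ ?_⟩
  have h1 := key (fun z ↦ ENNReal.ofReal (H z.1 z.2)) hH.ennreal_ofReal
  simp only at h1
  rw [h1, ENNReal.ofReal_mul hc]
  gcongr
  calc ∫⁻ p, ∫⁻ q, ENNReal.ofReal (H p q) ≤ ∫⁻ p, ENNReal.ofReal C * ENNReal.ofReal (G p) := by
        refine lintegral_mono_ae ?_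
        filter_upwards [Measure.ae_ne volume (0 : E)] with p hp
        rw [← ENNReal.ofReal_mul hC]
        exact hint p hp
    _ = ENNReal.ofReal C * ∫⁻ p, ENNReal.ofReal (G p) :=
        lintegral_const_mul' _ _ ENNReal.ofReal_ne_top
    _ ≤ ENNReal.ofReal C * 1 := by gcongr; exact hG.lintegral_le
    _ = ENNReal.ofReal C := mul_one _

lemma exists_lintegral_mul_le (hd : 1 ≤ finrank ℝ E) {θ : ι → ℝ}
    (hθ : Function.Injective θ) {o o' : Option ι} (h : o ≠ o') :
    ∃ C : ℝ, 0 ≤ C ∧ ∀ G G' : E → ℝ, IsSubdensity G → IsSubdensity G' →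
      ∫⁻ z : E × E, ENNReal.ofReal (G (shiftForm θ o z) * G' (shiftForm θ o' z))
        ≤ ENNReal.ofReal C := by
  obtain ⟨c, hc, H⟩ := exists_lintegral_shiftForm_le (E := E) hd hθ h
  refine ⟨c * 1, by positivity, fun G G' hG hG' ↦ ?_⟩
  have m1 := hG.measurable
  have m2 := hG'.measurable
  refine H 1 G (fun p q ↦ G p * G' q) zero_le_one hG (by unfold Function.uncurry; fun_prop)
    fun p _ ↦ ?_
  simp_rw [ENNReal.ofReal_mul (hG.nonneg p)]
  rw [lintegral_const_mul' _ _ ENNReal.ofReal_ne_top, one_mul]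
  exact (mul_le_mul_right hG'.lintegral_le _).trans (mul_one _).le

/-- The form without G is the smaller one. Its exponent 1 - s is below 1, so integrating over it
yields a multiple of ρ^{-s} at the other form, which cancels. -/
lemma exists_lintegral_mul_rieszDensity_le_of_pos (hd : 1 ≤ finrank ℝ E) {θ : ι → ℝ}
    (hθ : Function.Injective θ) {o o' : Option ι} (h : o ≠ o') {s : ℝ} (hs : 0 < s) :
    ∃ C : ℝ, 0 ≤ C ∧ ∀ G : E → ℝ, IsSubdensity G →
      ∫⁻ z : E × E, ENNReal.ofReal (G (shiftForm θ o z) *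
        (if rieszDensity (shiftForm θ o z) ≤ rieszDensity (shiftForm θ o' z) then
          rieszDensity (shiftForm θ o z) ^ s * rieszDensity (shiftForm θ o' z) ^ (1 - s) else 0))
        ≤ ENNReal.ofReal C := by
  obtain ⟨c, hc, H⟩ := exists_lintegral_shiftForm_le (E := E) hd hθ h
  obtain ⟨B, hB, hint⟩ := exists_lintegral_rieszDensity_ge_le (E := E) hd (s := 1 - s)
    (by linarith)
  refine ⟨c * B, by positivity, fun G hG ↦ ?_⟩
  have m1 := hG.measurable
  refine H B G (fun p q ↦ G p * (if rieszDensity p ≤ rieszDensity q then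
    rieszDensity p ^ s * rieszDensity q ^ (1 - s) else 0)) hB hG ?_ fun p hp ↦ ?_
  · unfold Function.uncurry
    exact (by fun_prop : Measurable fun a : E × E ↦ G a.1).mul
      (Measurable.ite (measurableSet_le (by fun_prop) (by fun_prop)) (by fun_prop) (by fun_prop))
  · have hp' := rieszDensity_pos hp
    have : ∀ q : E, G p * (if rieszDensity p ≤ rieszDensity q then
        rieszDensity p ^ s * rieszDensity q ^ (1 - s) else 0) = (G p * rieszDensity p ^ s) *
        (if rieszDensity p ≤ rieszDensity q then rieszDensity q ^ (1 - s) else 0) := fun q : E ↦ by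
      split_ifs <;> ring
    simp_rw [this]
    refine (lintegral_ofReal_const_mul_le_of_le (mul_nonneg (hG.nonneg p) (by positivity))
      (hint _ hp')).trans_eq ?_
    congr 1
    have : rieszDensity p ^ s * rieszDensity p ^ (1 - s - 1) = 1 := by
      rw [← Real.rpow_add hp']; norm_num
    linear_combination G p * B * this

/-- Now the form without G is the larger one, so convergence is needed at infinity; hence s > 1. -/
lemma exists_lintegral_mul_rieszDensity_le_of_one_lt (hd : 1 ≤ finrank ℝ E) {θ : ι → ℝ}
    (hθ : Function.Injective θ) {o o' : Option ι} (h : o ≠ o') {s : ℝ} (hs : 1 < s) :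
    ∃ C : ℝ, 0 ≤ C ∧ ∀ G : E → ℝ, IsSubdensity G →
      ∫⁻ z : E × E, ENNReal.ofReal (G (shiftForm θ o z) *
        (if rieszDensity (shiftForm θ o' z) ≤ rieszDensity (shiftForm θ o z) then
          rieszDensity (shiftForm θ o' z) ^ s * rieszDensity (shiftForm θ o z) ^ (1 - s) else 0))
        ≤ ENNReal.ofReal C := by
  obtain ⟨c, hc, H⟩ := exists_lintegral_shiftForm_le (E := E) hd hθ h
  obtain ⟨B, hB, hint⟩ := exists_lintegral_rieszDensity_le_le (E := E) hd hs
  refine ⟨c * B, by positivity, fun G hG ↦ ?_⟩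
  have m1 := hG.measurable
  refine H B G (fun p q ↦ G p * (if rieszDensity q ≤ rieszDensity p then
    rieszDensity q ^ s * rieszDensity p ^ (1 - s) else 0)) hB hG ?_ fun p hp ↦ ?_
  · unfold Function.uncurry
    exact (by fun_prop : Measurable fun a : E × E ↦ G a.1).mul
      (Measurable.ite (measurableSet_le (by fun_prop) (by fun_prop)) (by fun_prop) (by fun_prop))
  · have hp' := rieszDensity_pos hp
    have : ∀ q : E, G p * (if rieszDensity q ≤ rieszDensity p then
        rieszDensity q ^ s * rieszDensity p ^ (1 - s) else 0) = (G p * rieszDensity p ^ (1 - s)) *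
        (if rieszDensity q ≤ rieszDensity p then rieszDensity q ^ s else 0) := fun q : E ↦ by
      split_ifs <;> ring
    simp_rw [this]
    refine (lintegral_ofReal_const_mul_le_of_le (mul_nonneg (hG.nonneg p) (by positivity))
      (hint _ hp')).trans_eq ?_
    congr 1
    have : rieszDensity p ^ (1 - s) * rieszDensity p ^ (s - 1) = 1 := by
      rw [← Real.rpow_add hp']; norm_num
    linear_combination G p * B * this

/-- The cut is at the level of G itself: the tail integral is a multiple of G^{1-u}, which restores
G to the first power. -/
lemma exists_lintegral_rpow_mul_rieszDensity_le_le (hd : 1 ≤ finrank ℝ E) {θ : ι → ℝ}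
    (hθ : Function.Injective θ) {o o' : Option ι} (h : o ≠ o') {u : ℝ} (hu : u < 1) :
    ∃ C : ℝ, 0 ≤ C ∧ ∀ G : E → ℝ, IsSubdensity G →
      ∫⁻ z : E × E, ENNReal.ofReal (G (shiftForm θ o z) ^ u *
        (if rieszDensity (shiftForm θ o' z) ≤ G (shiftForm θ o z) then
          rieszDensity (shiftForm θ o' z) ^ (2 - u) else 0))
        ≤ ENNReal.ofReal C := by
  obtain ⟨c, hc, H⟩ := exists_lintegral_shiftForm_le (E := E) hd hθ h
  obtain ⟨B, hB, hint⟩ := exists_lintegral_rieszDensity_le_le (E := E) hd (s := 2 - u)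
    (by linarith)
  refine ⟨c * B, by positivity, fun G hG ↦ ?_⟩
  have m1 := hG.measurable
  refine H B G (fun p q ↦ G p ^ u * (if rieszDensity q ≤ G p then
    rieszDensity q ^ (2 - u) else 0)) hB hG ?_ fun p hp ↦ ?_
  · unfold Function.uncurry
    exact (by fun_prop : Measurable fun a : E × E ↦ G a.1 ^ u).mul
      (Measurable.ite (measurableSet_le (by fun_prop) (by fun_prop)) (by fun_prop) (by fun_prop))
  -- Where G = 0, the factor G^u may be 0^0 = 1, so the vanishing has to come from the truncated
  -- power.
  · rcases (hG.nonneg p).eq_or_lt with h0 | h0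
    · have : ∀ q : E, (if rieszDensity q ≤ G p then rieszDensity q ^ (2 - u) else 0) = 0 := by
        intro q
        split_ifs with hq
        · rw [le_antisymm (hq.trans h0.ge) (rieszDensity_nonneg q),
            Real.zero_rpow (by linarith)]
        · rfl
      simp [this]
    · refine (lintegral_ofReal_const_mul_le_of_le (by positivity) (hint _ h0)).trans_eq ?_
      congr 1
      have : G p ^ u * G p ^ (2 - u - 1) = G p := by
        rw [← Real.rpow_add h0]; ring_nf; rw [Real.rpow_one]
      linear_combination B * this

lemma exists_lintegral_rpow_mul_le_rieszDensity_le (hd : 1 ≤ finrank ℝ E) {θ : ι → ℝ}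
    (hθ : Function.Injective θ) {o o' : Option ι} (h : o ≠ o') {V : ℝ} (hV : 1 < V) :
    ∃ C : ℝ, 0 ≤ C ∧ ∀ G : E → ℝ, IsSubdensity G →
      ∫⁻ z : E × E, ENNReal.ofReal (G (shiftForm θ o z) ^ V *
        (if G (shiftForm θ o z) ≤ rieszDensity (shiftForm θ o' z) then
          rieszDensity (shiftForm θ o' z) ^ (2 - V) else 0))
        ≤ ENNReal.ofReal C := by
  obtain ⟨c, hc, H⟩ := exists_lintegral_shiftForm_le (E := E) hd hθ h
  obtain ⟨B, hB, hint⟩ := exists_lintegral_rieszDensity_ge_le (E := E) hd (s := 2 - V)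
    (by linarith)
  refine ⟨c * B, by positivity, fun G hG ↦ ?_⟩
  have m1 := hG.measurable
  refine H B G (fun p q ↦ G p ^ V * (if G p ≤ rieszDensity q then
    rieszDensity q ^ (2 - V) else 0)) hB hG ?_ fun p hp ↦ ?_
  · unfold Function.uncurry
    exact (by fun_prop : Measurable fun a : E × E ↦ G a.1 ^ V).mul
      (Measurable.ite (measurableSet_le (by fun_prop) (by fun_prop)) (by fun_prop) (by fun_prop))
  · rcases (hG.nonneg p).eq_or_lt with h0 | h0
    · simp [← h0, Real.zero_rpow (by linarith : V ≠ 0)]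
    · refine (lintegral_ofReal_const_mul_le_of_le (by positivity) (hint _ h0)).trans_eq ?_
      congr 1
      have : G p ^ V * G p ^ (2 - V - 1) = G p := by
        rw [← Real.rpow_add h0]; ring_nf; rw [Real.rpow_one]
      linear_combination B * this

end TwoForms

/-! ### Integration over the ordered regions. -/

section Core

open Module

variable {E : Type*} [NormedAddCommGroup E] [NormedSpace ℝ E] {ι : Type*} [Fintype ι]

/-- The integrand of the form, written in terms of densities. -/
noncomputable def densityIntegrand (θ : ι → ℝ) (e : Option ι → ℝ) (v : ι → ℝ) (G : ι → E → ℝ)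
    (z : E × E) : ℝ :=
  (∏ o, rieszDensity (shiftForm θ o z) ^ e o) * ∏ j, G j (shiftForm θ (some j) z) ^ v j

/-- The points at which `l` is the smallest form, and the densities with indices `a` and `b` have
the two largest values. -/
def orderedRegion (θ : ι → ℝ) (G : ι → E → ℝ) (l : Option ι) (a b : ι) : Set (E × E) :=
  {z | (∀ o, shiftForm θ o z ≠ 0) ∧ (∀ o, ‖shiftForm θ l z‖ ≤ ‖shiftForm θ o z‖) ∧
    G b (shiftForm θ (some b) z) ≤ G a (shiftForm θ (some a) z) ∧
    ∀ j, j ≠ a → G j (shiftForm θ (some j) z) ≤ G b (shiftForm θ (some b) z)}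

lemma exists_mem_orderedRegion [Nontrivial ι] (θ : ι → ℝ) (G : ι → E → ℝ) {z : E × E}
    (hz : ∀ o, shiftForm θ o z ≠ 0) :
    ∃ l a b, a ≠ b ∧ z ∈ orderedRegion θ G l a b := by
  classical
  obtain ⟨l, hl⟩ := Finite.exists_min fun o ↦ ‖shiftForm θ o z‖
  obtain ⟨a, ha⟩ := Finite.exists_max fun j ↦ G j (shiftForm θ (some j) z)
  obtain ⟨c, hc⟩ := exists_ne a
  obtain ⟨b, hb, hb'⟩ := Finset.exists_max_image (Finset.univ.erase a)
    (fun j ↦ G j (shiftForm θ (some j) z)) ⟨c, by simpa using hc⟩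
  exact ⟨l, a, b, (Finset.ne_of_mem_erase hb).symm, hz, hl, ha b, fun j hj ↦ hb' j (by simpa using hj)⟩

/-- On an ordered region only the smallest form, a reference form and two densities matter. -/
lemma exists_densityIntegrand_le {θ : ι → ℝ} (hθ : Function.Injective θ) (e : Option ι → ℝ)
    {v : ι → ℝ} (hv : ∀ j, 0 ≤ v j) {l i : Option ι} (hi : i ≠ l) (a b : ι) :
    ∃ C : ℝ, 0 ≤ C ∧ ∀ G : ι → E → ℝ, (∀ j x, 0 ≤ G j x) → ∀ z ∈ orderedRegion θ G l a b,
      densityIntegrand θ e v G z ≤ C *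
        (G a (shiftForm θ (some a) z) ^ v a * G b (shiftForm θ (some b) z) ^ (∑ j, v j - v a) *
          (rieszDensity (shiftForm θ i z) ^ (∑ o, e o - e l) *
            rieszDensity (shiftForm θ l z) ^ e l)) := by
  classical
  obtain ⟨C, hC, H⟩ := exists_prod_rieszDensity_rpow_le (E := E) hθ hi e
  refine ⟨C, hC, fun G hG z hz ↦ ?_⟩
  have h1 := prod_rpow_le_of_isMax (G := fun j ↦ G j (shiftForm θ (some j) z)) (v := v) (a := a)
    (b := b) (fun j ↦ hG j _) hv hz.2.2.2
  refine (mul_le_mul (H z hz.1 hz.2.1) h1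
    (Finset.prod_nonneg fun j _ ↦ Real.rpow_nonneg (hG j _) _) ?_).trans_eq ?_
  · exact mul_nonneg hC (mul_nonneg (Real.rpow_nonneg (rieszDensity_nonneg _) _)
      (Real.rpow_nonneg (rieszDensity_nonneg _) _))
  · ring

variable [FiniteDimensional ℝ E] [MeasureSpace E] [BorelSpace E]
  [(volume : Measure E).IsAddHaarMeasure]

/-- The form carrying A is not the smallest, so it serves as reference form. A positive total weight
off l is exactly s > 0. -/
lemma exists_lintegral_orderedRegion_le_of_ne (hd : 1 ≤ finrank ℝ E) {θ : ι → ℝ}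
    (hθ : Function.Injective θ) {e : Option ι → ℝ} {v : ι → ℝ} (hv0 : ∀ j, 0 ≤ v j)
    (hv1 : ∀ j, v j < 1) (hscale : ∑ o, e o + ∑ j, v j = 2) (hV : 1 ≤ ∑ j, v j)
    (he : 0 < ∑ o, e o) {l : Option ι} {a b : ι} (hab : a ≠ b) (hal : some a ≠ l)
    (hl : 0 < ∑ o, e o - e l) :
    ∃ C : ℝ, 0 ≤ C ∧ ∀ G : ι → E → ℝ, (∀ j, IsSubdensity (G j)) →
      ∫⁻ z in orderedRegion θ G l a b, ENNReal.ofReal (densityIntegrand θ e v G z)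
        ≤ ENNReal.ofReal C := by
  obtain ⟨C₀, hC₀, H₀⟩ := exists_densityIntegrand_le (E := E) hθ e hv0 hal a b
  have hab' : some a ≠ some b := fun h ↦ hab (Option.some_injective _ h)
  obtain ⟨C₁, hC₁, H₁⟩ := exists_lintegral_mul_le (E := E) hd hθ hab'
  obtain ⟨C₂, hC₂, H₂⟩ := exists_lintegral_mul_rieszDensity_le_of_pos (E := E) hd hθ hal
    (s := (∑ o, e o - e l) / (2 - ∑ j, v j)) (div_pos hl (by linarith))
  refine ⟨C₀ * (C₁ + C₂), by positivity, fun G hG ↦ ?_⟩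
  have ma := (hG a).measurable
  have mb := (hG b).measurable
  refine le_trans ?_ (lintegral_ofReal_const_mul_le_of_le hC₀ (lintegral_ofReal_add_le_of_le
    (by fun_prop) hC₁ hC₂ (H₁ _ _ (hG a) (hG b)) (H₂ _ (hG a))))
  refine (setLIntegral_mono ?_ fun z hz ↦ ENNReal.ofReal_le_ofReal ?_).trans
    (setLIntegral_le_lintegral _ _)
  · exact (((by fun_prop : Measurable _).add ((by fun_prop : Measurable _).mul (Measurable.ite
      (measurableSet_le (by fun_prop) (by fun_prop)) (by fun_prop) (by fun_prop)))).const_mul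
        C₀).ennreal_ofReal
  · refine (H₀ G (fun j ↦ (hG j).nonneg) z hz).trans (mul_le_mul_of_nonneg_left ?_ hC₀)
    rw [if_pos (rieszDensity_le (hz.1 _) (hz.2.1 _))]
    exact mul_rpow_le_of_ne ((hG b).nonneg _) hz.2.2.1 (rieszDensity_pos (hz.1 _))
      (rieszDensity_pos (hz.1 _)) (hv1 a).le (by linarith [hv1 a]) hV (by linarith) (by linarith)

/-- The smallest form carries A, so A K^s L^{1-s} must be integrated over the larger reference form,
which needs s > 1. The third term pairs B with the smallest form and needs only t > 0. -/
lemma exists_lintegral_orderedRegion_le_of_eq (hd : 1 ≤ finrank ℝ E) {θ : ι → ℝ}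
    (hθ : Function.Injective θ) {e : Option ι → ℝ} {v : ι → ℝ} (hv0 : ∀ j, 0 ≤ v j)
    (hv1 : ∀ j, v j < 1) (hscale : ∑ o, e o + ∑ j, v j = 2) (hV : 1 ≤ ∑ j, v j)
    (he : 0 < ∑ o, e o) {a b : ι} (hab : a ≠ b) (hl : 0 < ∑ o, e o - e (some a))
    (hlt : v a + e (some a) < 1) :
    ∃ C : ℝ, 0 ≤ C ∧ ∀ G : ι → E → ℝ, (∀ j, IsSubdensity (G j)) →
      ∫⁻ z in orderedRegion θ G (some a) a b, ENNReal.ofReal (densityIntegrand θ e v G z)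
        ≤ ENNReal.ofReal C := by
  have hab' : some a ≠ some b := fun h ↦ hab (Option.some_injective _ h)
  have han : some a ≠ none := by simp
  obtain ⟨C₀, hC₀, H₀⟩ := exists_densityIntegrand_le (E := E) hθ e hv0 han.symm a b
  obtain ⟨s, t, hs, ht, hst⟩ := exists_mul_rpow_le_of_eq (hv0 a) (hv1 a) hV (by linarith)
    (m := ∑ o, e o - e (some a)) (n := e (some a)) (by linarith) hl hlt
  obtain ⟨C₁, hC₁, H₁⟩ := exists_lintegral_mul_le (E := E) hd hθ hab'
  obtain ⟨C₂, hC₂, H₂⟩ := exists_lintegral_mul_rieszDensity_le_of_one_lt (E := E) hd hθ han hs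
  obtain ⟨C₃, hC₃, H₃⟩ := exists_lintegral_mul_rieszDensity_le_of_pos (E := E) hd hθ hab'.symm ht
  -- Moves K from form y to the form carrying B, so that the third term involves only two forms.
  obtain ⟨D, hD, HD⟩ := exists_rieszDensity_rpow_le (E := E) hθ han.symm hab'.symm t
  refine ⟨C₀ * ((C₁ + C₂) + D * C₃), by positivity, fun G hG ↦ ?_⟩
  have ma := (hG a).measurable
  have mb := (hG b).measurable
  have mb1 : Measurable fun z : E × E ↦
      G a (shiftForm θ (some a) z) * G b (shiftForm θ (some b) z) := by fun_prop
  have mb2 : Measurable fun z : E × E ↦ G a (shiftForm θ (some a) z) *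
      (if rieszDensity (shiftForm θ none z) ≤ rieszDensity (shiftForm θ (some a) z) then
        rieszDensity (shiftForm θ none z) ^ s * rieszDensity (shiftForm θ (some a) z) ^ (1 - s)
        else 0) :=
    (by fun_prop : Measurable _).mul (Measurable.ite
      (measurableSet_le (by fun_prop) (by fun_prop)) (by fun_prop) (by fun_prop))
  refine le_trans ?_ (lintegral_ofReal_const_mul_le_of_le hC₀ (lintegral_ofReal_add_le_of_le
    (mb1.add mb2) (add_nonneg hC₁ hC₂) (mul_nonneg hD hC₃)
    (lintegral_ofReal_add_le_of_le mb1 hC₁ hC₂ (H₁ _ _ (hG a) (hG b)) (H₂ _ (hG a)))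
    (lintegral_ofReal_const_mul_le_of_le hD (H₃ _ (hG b)))))
  refine (setLIntegral_mono ?_ fun z hz ↦ ENNReal.ofReal_le_ofReal ?_).trans
    (setLIntegral_le_lintegral _ _)
  · exact (((mb1.add mb2).add (((by fun_prop : Measurable _).mul (Measurable.ite
      (measurableSet_le (by fun_prop) (by fun_prop)) (by fun_prop) (by fun_prop))).const_mul
        D)).const_mul C₀).ennreal_ofReal
  · refine (H₀ G (fun j ↦ (hG j).nonneg) z hz).trans (mul_le_mul_of_nonneg_left ?_ hC₀)
    simp only [Pi.add_apply]
    rw [if_pos (rieszDensity_le (hz.1 _) (hz.2.1 _)), if_pos (rieszDensity_le (hz.1 _) (hz.2.1 _))]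
    refine (hst _ _ _ _ ((hG b).nonneg _) hz.2.2.1 (rieszDensity_pos (hz.1 _))
      (rieszDensity_pos (hz.1 _))).trans (add_le_add le_rfl ?_)
    have h1 := HD z hz.1 hz.2.1
    have h2 := (hG b).nonneg (shiftForm θ (some b) z)
    have h3 := Real.rpow_nonneg (rieszDensity_nonneg (shiftForm θ (some a) z)) (1 - t)
    calc _ ≤ G b (shiftForm θ (some b) z) * (D * rieszDensity (shiftForm θ (some b) z) ^ t *
            rieszDensity (shiftForm θ (some a) z) ^ (1 - t)) := by gcongr
      _ = _ := by ring

/-- The weights at the other forms have total exponent 0 and cancel up to constants. What remains is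
the unweighted Hardy–Littlewood–Sobolev kernel with exponent 2 - V < 1. -/
lemma exists_lintegral_orderedRegion_none_le (hd : 1 ≤ finrank ℝ E) {θ : ι → ℝ}
    (hθ : Function.Injective θ) {e : Option ι → ℝ} {v : ι → ℝ} (hv0 : ∀ j, 0 ≤ v j)
    (hv1 : ∀ j, v j < 1) (hscale : ∑ o, e o + ∑ j, v j = 2)
    (he : 0 < e none) (he1 : e none < 1) {a b : ι} (hab : a ≠ b)
    (hl : ∑ o, e o - e none = 0) :
    ∃ C : ℝ, 0 ≤ C ∧ ∀ G : ι → E → ℝ, (∀ j, IsSubdensity (G j)) →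
      ∫⁻ z in orderedRegion θ G none a b, ENNReal.ofReal (densityIntegrand θ e v G z)
        ≤ ENNReal.ofReal C := by
  have hab' : some a ≠ some b := fun h ↦ hab (Option.some_injective _ h)
  have han : some a ≠ none := by simp
  obtain ⟨C₀, hC₀, H₀⟩ := exists_densityIntegrand_le (E := E) hθ e hv0 han a b
  obtain ⟨C₁, hC₁, H₁⟩ := exists_lintegral_mul_le (E := E) hd hθ hab'
  obtain ⟨C₂, hC₂, H₂⟩ := exists_lintegral_rpow_mul_rieszDensity_le_le (E := E) hd hθ han (hv1 a)
  obtain ⟨C₃, hC₃, H₃⟩ := exists_lintegral_rpow_mul_le_rieszDensity_le (E := E) hd hθ han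
    (V := ∑ j, v j) (by linarith)
  refine ⟨C₀ * ((C₁ + C₂) + C₃), by positivity, fun G hG ↦ ?_⟩
  have ma := (hG a).measurable
  have mb := (hG b).measurable
  have mb1 : Measurable fun z : E × E ↦
      G a (shiftForm θ (some a) z) * G b (shiftForm θ (some b) z) := by fun_prop
  have mb2 : Measurable fun z : E × E ↦ G a (shiftForm θ (some a) z) ^ v a *
      (if rieszDensity (shiftForm θ none z) ≤ G a (shiftForm θ (some a) z) then
        rieszDensity (shiftForm θ none z) ^ (2 - v a) else 0) :=
    (by fun_prop : Measurable _).mul (Measurable.ite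
      (measurableSet_le (by fun_prop) (by fun_prop)) (by fun_prop) (by fun_prop))
  refine le_trans ?_ (lintegral_ofReal_const_mul_le_of_le hC₀ (lintegral_ofReal_add_le_of_le
    (mb1.add mb2) (add_nonneg hC₁ hC₂) hC₃
    (lintegral_ofReal_add_le_of_le mb1 hC₁ hC₂ (H₁ _ _ (hG a) (hG b)) (H₂ _ (hG a)))
    (H₃ _ (hG a))))
  refine (setLIntegral_mono ?_ fun z hz ↦ ENNReal.ofReal_le_ofReal ?_).trans
    (setLIntegral_le_lintegral _ _)
  · exact (((mb1.add mb2).add ((by fun_prop : Measurable _).mul (Measurable.ite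
      (measurableSet_le (by fun_prop) (by fun_prop)) (by fun_prop) (by fun_prop)))).const_mul
        C₀).ennreal_ofReal
  · refine (H₀ G (fun j ↦ (hG j).nonneg) z hz).trans (mul_le_mul_of_nonneg_left ?_ hC₀)
    have h2V : e none = 2 - ∑ j, v j := by linarith
    rw [hl, Real.rpow_zero, one_mul, h2V]
    exact mul_rpow_le_hardyLittlewoodSobolev ((hG b).nonneg _) hz.2.2.1
      (rieszDensity_pos (hz.1 _)) (hv0 a) (hv1 a).le (by linarith [hv1 a]) (by linarith)

theorem exists_lintegral_densityIntegrand_le (hd : 1 ≤ finrank ℝ E) {θ : ι → ℝ}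
    (hθ : Function.Injective θ) {e : Option ι → ℝ} {v : ι → ℝ} (hv0 : ∀ j, 0 ≤ v j)
    (hv1 : ∀ j, v j < 1) (hscale : ∑ o, e o + ∑ j, v j = 2) (hV : 1 ≤ ∑ j, v j)
    (he : 0 < e none) (he1 : e none < 1) (hlt : ∀ j, v j + e (some j) < 1)
    (hnone : 0 ≤ ∑ o, e o - e none) (hsome : ∀ j, 0 < ∑ o, e o - e (some j)) :
    ∃ C : ℝ, 0 ≤ C ∧ ∀ G : ι → E → ℝ, (∀ j, IsSubdensity (G j)) →
      ∫⁻ z, ENNReal.ofReal (densityIntegrand θ e v G z) ≤ ENNReal.ofReal C := by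
  have hE : Nontrivial E := Module.nontrivial_of_finrank_pos (R := ℝ) hd
  -- With at most one density, every exponent being below 1 contradicts V ≥ 1.
  have hι : Nontrivial ι := by
    by_contra h
    rw [not_nontrivial_iff_subsingleton] at h
    rcases isEmpty_or_nonempty ι with h' | ⟨⟨i⟩⟩
    · simp at hV
      linarith
    · have : Unique ι := ⟨⟨i⟩, fun _ ↦ Subsingleton.elim _ _⟩
      rw [Fintype.sum_unique] at hV
      linarith [hv1 default]
  have region : ∀ r : Option ι × ι × ι, ∃ C : ℝ, 0 ≤ C ∧ (r.2.1 ≠ r.2.2 →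
      ∀ G : ι → E → ℝ, (∀ j, IsSubdensity (G j)) →
      ∫⁻ z in orderedRegion θ G r.1 r.2.1 r.2.2, ENNReal.ofReal (densityIntegrand θ e v G z)
        ≤ ENNReal.ofReal C) := by
    rintro ⟨l, a, b⟩
    by_cases hab : a = b
    · exact ⟨0, le_rfl, fun h ↦ absurd hab h⟩
    have key : ∃ C : ℝ, 0 ≤ C ∧ ∀ G : ι → E → ℝ, (∀ j, IsSubdensity (G j)) →
        ∫⁻ z in orderedRegion θ G l a b, ENNReal.ofReal (densityIntegrand θ e v G z)
          ≤ ENNReal.ofReal C := by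
      have he' : 0 < ∑ o, e o := by linarith
      cases l with
      | none =>
        rcases hnone.eq_or_lt with h | h
        · exact exists_lintegral_orderedRegion_none_le hd hθ hv0 hv1 hscale he he1 hab h.symm
        · exact exists_lintegral_orderedRegion_le_of_ne hd hθ hv0 hv1 hscale hV he' hab (by simp) h
      | some i =>
        by_cases hai : a = i
        · subst hai
          exact exists_lintegral_orderedRegion_le_of_eq hd hθ hv0 hv1 hscale hV he' hab (hsome a)
            (hlt a)
        · exact exists_lintegral_orderedRegion_le_of_ne hd hθ hv0 hv1 hscale hV he' hab
            (by simpa using hai) (hsome i)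
    exact key.imp fun C h ↦ ⟨h.1, fun _ ↦ h.2⟩
  choose C hC H using region
  refine ⟨∑ r, C r, Finset.sum_nonneg fun r _ ↦ hC r, fun G hG ↦ ?_⟩
  set S : Option ι × ι × ι → Set (E × E) := fun r ↦
    {z | r.2.1 ≠ r.2.2 ∧ z ∈ orderedRegion θ G r.1 r.2.1 r.2.2}
  have hS : ∀ᵐ z : E × E, z ∈ ⋃ r, S r := by
    have h0 : ∀ᵐ z : E × E, ∀ o, shiftForm θ o z ≠ 0 := ae_all_iff.2 fun o ↦
      (quasiMeasurePreserving_shiftForm hθ o).ae (Measure.ae_ne volume (0 : E))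
    filter_upwards [h0] with z hz
    obtain ⟨l, a, b, hab, h⟩ := exists_mem_orderedRegion θ G hz
    exact Set.mem_iUnion.2 ⟨(l, a, b), hab, h⟩
  rw [← setLIntegral_univ, ← setLIntegral_congr (Filter.eventuallyEq_univ.2 hS)]
  refine (lintegral_iUnion_le _ _).trans ?_
  rw [tsum_fintype, ENNReal.ofReal_sum_of_nonneg fun r _ ↦ hC r]
  refine Finset.sum_le_sum fun r _ ↦ ?_
  by_cases hr : r.2.1 = r.2.2
  · have : S r = ∅ := Set.eq_empty_of_forall_notMem fun z hz ↦ hz.1 hr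
    simp [this]
  · exact (lintegral_mono_set fun z hz ↦ hz.2).trans (H r hr G hG)

end Core

/-! ### Reduction of the theorem to densities. -/

/-- For finite p take G = (|x|^w |f| / M)^p. Only an upper bound M > 0 for the norm is used, which
avoids dividing by a zero norm. -/
lemma exists_isSubdensity_norm_le {k : ℕ} (hk : 1 ≤ k) {p : ℝ≥0∞} (hp : 1 < p) {w : ℝ}
    {f : EuclideanSpace ℝ (Fin k) → ℂ} (hf : AEStronglyMeasurable f volume) {M : ℝ} (hM : 0 < M)
    (hfM : weightedLpNorm p w f ≤ ENNReal.ofReal M) :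
    ∃ G : EuclideanSpace ℝ (Fin k) → ℝ, IsSubdensity G ∧
      ∀ᵐ x, ‖f x‖ ≤ M * (‖x‖ ^ (-w) * G x ^ (p⁻¹).toReal) := by
  have : Nontrivial (EuclideanSpace ℝ (Fin k)) :=
    Module.nontrivial_of_finrank_pos (R := ℝ) (by simpa using Nat.lt_of_succ_le hk)
  set h : EuclideanSpace ℝ (Fin k) → ℂ := fun x ↦ (‖x‖ ^ w : ℝ) • f x with hh
  have hmeas : AEStronglyMeasurable h volume :=
    ((by fun_prop : Measurable fun x : EuclideanSpace ℝ (Fin k) ↦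
      ‖x‖ ^ w).aestronglyMeasurable).smul hf
  have hnorm : eLpNorm h p volume ≤ ENNReal.ofReal M := hfM
  have hfh : ∀ x, x ≠ 0 → ‖f x‖ = ‖x‖ ^ (-w) * ‖h x‖ := fun x hx ↦ by
    have hx' : 0 < ‖x‖ := norm_pos_iff.2 hx
    rw [hh, norm_smul, Real.norm_of_nonneg (by positivity), ← mul_assoc, ← Real.rpow_add hx',
      neg_add_cancel, Real.rpow_zero, one_mul]
  rcases eq_or_ne p ∞ with rfl | hp'
  -- For p = ∞ the exponent of G is 0 and 0^0 = 1, so G = 0 suffices.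
  · refine ⟨fun _ ↦ 0, ⟨measurable_const, fun _ ↦ le_rfl, by simp⟩, ?_⟩
    rw [eLpNorm_exponent_top] at hnorm
    filter_upwards [ae_le_eLpNormEssSup (f := h) (μ := volume), Measure.ae_ne volume 0] with x hx hx0
    have h1 := hx.trans hnorm
    rw [← ofReal_norm, ENNReal.ofReal_le_ofReal_iff hM.le] at h1
    rw [hfh x hx0]
    simp only [ENNReal.inv_top, ENNReal.toReal_zero, Real.rpow_zero, mul_one]
    rw [mul_comm]
    exact mul_le_mul_of_nonneg_right h1 (by positivity)
  · have hp0 : p ≠ 0 := (zero_lt_one.trans hp).ne'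
    have hpr : 0 < p.toReal := ENNReal.toReal_pos hp0 hp'
    have hmk := hmeas.ae_eq_mk
    refine ⟨fun x ↦ (M⁻¹ * ‖hmeas.mk h x‖) ^ p.toReal, ⟨?_, fun x ↦ by positivity, ?_⟩, ?_⟩
    · have := hmeas.stronglyMeasurable_mk.measurable
      fun_prop
    · have h1 : ∀ x, ENNReal.ofReal ((M⁻¹ * ‖hmeas.mk h x‖) ^ p.toReal)
          = ENNReal.ofReal M⁻¹ ^ p.toReal * ‖hmeas.mk h x‖ₑ ^ p.toReal := fun x ↦ by
        rw [← ENNReal.ofReal_rpow_of_nonneg (by positivity) hpr.le,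
          ENNReal.ofReal_mul (by positivity), ENNReal.mul_rpow_of_nonneg _ _ hpr.le, ofReal_norm]
      simp_rw [h1]
      rw [lintegral_const_mul' _ _ (ENNReal.rpow_ne_top_of_nonneg hpr.le ENNReal.ofReal_ne_top)]
      rw [eLpNorm_congr_ae hmk] at hnorm
      rw [eLpNorm_eq_lintegral_rpow_enorm_toReal hp0 hp', one_div,
        ENNReal.rpow_inv_le_iff hpr] at hnorm
      calc _ ≤ ENNReal.ofReal M⁻¹ ^ p.toReal * ENNReal.ofReal M ^ p.toReal := by gcongr
        _ = 1 := by
          rw [← ENNReal.mul_rpow_of_nonneg _ _ hpr.le, ← ENNReal.ofReal_mul (by positivity),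
            inv_mul_cancel₀ hM.ne', ENNReal.ofReal_one, ENNReal.one_rpow]
    · filter_upwards [hmk, Measure.ae_ne volume 0] with x hx hx0
      rw [hfh x hx0, hx, ENNReal.toReal_inv, Real.rpow_rpow_inv (by positivity) hpr.ne']
      refine le_of_eq ?_
      field_simp

/-- Prepending θ_0 = 0 puts f_0(x) on the same footing as the other factors. -/
lemma fracIntegrand_eq_prod {k N : ℕ} (θ : Fin N → ℝ)
    (f : Fin (N + 1) → EuclideanSpace ℝ (Fin k) → ℂ) (g : EuclideanSpace ℝ (Fin k) → ℂ)
    (z : EuclideanSpace ℝ (Fin k) × EuclideanSpace ℝ (Fin k)) :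
    fracIntegrand θ f g z
      = g z.2 * ∏ j, f j (shiftForm (Fin.cons 0 θ : Fin (N + 1) → ℝ) (some j) z) := by
  rw [fracIntegrand, Fin.prod_univ_succ, mul_assoc]
  simp

lemma aestronglyMeasurable_fracIntegrand {k N : ℕ} {θ : Fin N → ℝ}
    (hθ : Function.Injective (Fin.cons 0 θ : Fin (N + 1) → ℝ))
    {f : Fin (N + 1) → EuclideanSpace ℝ (Fin k) → ℂ} {g : EuclideanSpace ℝ (Fin k) → ℂ}
    (hf : ∀ j, AEStronglyMeasurable (f j) volume) (hg : AEStronglyMeasurable g volume) :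
    AEStronglyMeasurable (fracIntegrand θ f g) volume := by
  have h1 : AEStronglyMeasurable
      (fun z : EuclideanSpace ℝ (Fin k) × EuclideanSpace ℝ (Fin k) ↦ g z.2) volume :=
    hg.comp_quasiMeasurePreserving (quasiMeasurePreserving_shiftForm hθ none)
  have h2 := Finset.aestronglyMeasurable_fun_prod Finset.univ fun j (_ : j ∈ Finset.univ) ↦
    (hf j).comp_quasiMeasurePreserving (quasiMeasurePreserving_shiftForm hθ (some j))
  refine (h1.mul h2).congr (Filter.Eventually.of_forall fun z ↦ ?_)
  rw [fracIntegrand_eq_prod]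
  rfl

lemma lintegral_fracIntegrand_le {k N : ℕ} (hk : 1 ≤ k) {θ : Fin N → ℝ}
    (hθ : Function.Injective (Fin.cons 0 θ : Fin (N + 1) → ℝ)) {lam : ℝ}
    {p : Fin (N + 1) → ℝ≥0∞} {w : Fin (N + 1) → ℝ} (hp : ∀ j, 1 < p j) {C : ℝ}
    (hC : ∀ G : Fin (N + 1) → EuclideanSpace ℝ (Fin k) → ℝ, (∀ j, IsSubdensity (G j)) →
      ∫⁻ z, ENNReal.ofReal (densityIntegrand (Fin.cons 0 θ : Fin (N + 1) → ℝ)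
        (fun o ↦ o.elim (lam / k) fun j ↦ w j / k) (fun j ↦ (p j)⁻¹.toReal) G z)
          ≤ ENNReal.ofReal C)
    {f : Fin (N + 1) → EuclideanSpace ℝ (Fin k) → ℂ} (hf : ∀ j, AEStronglyMeasurable (f j) volume)
    {M : Fin (N + 1) → ℝ} (hM : ∀ j, 0 < M j)
    (hfM : ∀ j, weightedLpNorm (p j) (w j) (f j) ≤ ENNReal.ofReal (M j)) :
    ∫⁻ z, ‖fracIntegrand θ f (powerKernel lam) z‖ₑ ≤ ENNReal.ofReal ((∏ j, M j) * C) := by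
  have hk' : (k : ℝ) ≠ 0 := by positivity
  have hM' : 0 ≤ ∏ j, M j := Finset.prod_nonneg fun j _ ↦ (hM j).le
  choose G hG hfG using fun j ↦ exists_isSubdensity_norm_le hk (hp j) (hf j) (hM j) (hfM j)
  refine le_trans (lintegral_mono_ae ?_) (lintegral_ofReal_const_mul_le_of_le hM' (hC G hG))
  have hae := ae_all_iff.2 fun j ↦ (quasiMeasurePreserving_shiftForm hθ (some j)).ae (hfG j)
  filter_upwards [hae] with z hz
  rw [← ofReal_norm]
  refine ENNReal.ofReal_le_ofReal ?_
  have hpow : ∀ (x : EuclideanSpace ℝ (Fin k)) (r : ℝ), rieszDensity x ^ (r / k) = ‖x‖ ^ (-r) :=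
    fun x r ↦ by
      rw [rieszDensity_rpow, finrank_euclideanSpace_fin, mul_div_cancel₀ _ hk']
  have hker : ‖powerKernel lam z.2‖ = ‖z.2‖ ^ (-lam) := by
    rw [powerKernel, Complex.norm_real, Real.norm_of_nonneg (by positivity)]
  rw [fracIntegrand_eq_prod, norm_mul, norm_prod, hker]
  calc ‖z.2‖ ^ (-lam) * ∏ j, ‖f j (shiftForm (Fin.cons 0 θ : Fin (N + 1) → ℝ) (some j) z)‖
      ≤ ‖z.2‖ ^ (-lam) * ∏ j, (M j * (‖shiftForm (Fin.cons 0 θ : Fin (N + 1) → ℝ) (some j) z‖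
          ^ (-w j) * G j (shiftForm (Fin.cons 0 θ : Fin (N + 1) → ℝ) (some j) z)
            ^ (p j)⁻¹.toReal)) := by
        refine mul_le_mul_of_nonneg_left ?_ (by positivity)
        exact Finset.prod_le_prod (fun j _ ↦ norm_nonneg _) fun j _ ↦ hz j
    _ = _ := by
        simp only [densityIntegrand, Fintype.prod_option, Option.elim_none, Option.elim_some, hpow,
          shiftForm_none, Finset.prod_mul_distrib]
        ring

theorem theorem4p1 (k N : ℕ) (hk : 1 ≤ k)
    (θ : Fin N → ℝ) (hθ_ne : ∀ j, θ j ≠ 0) (hθ_inj : Function.Injective θ)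
    (lam : ℝ) (p : Fin (N + 1) → ℝ≥0∞) (w : Fin (N + 1) → ℝ)
    (hp : ∀ j, 1 < p j)
    (hscale : lam / k + ∑ j, ((p j)⁻¹.toReal + w j / k) = 2)
    (hlam_pos : 0 < lam / k) (hlam_lt : lam / k < 1)
    (hlt : ∀ j, (p j)⁻¹.toReal + w j / k < 1)
    (hsum : 1 ≤ ∑ j, (p j)⁻¹.toReal)
    (hw : 0 ≤ ∑ j, w j)
    (hw_strict : ∀ l, 0 < lam + ∑ j ∈ Finset.univ.erase l, w j) :
    ∃ C : ℝ, 0 ≤ C ∧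
      ∀ f : Fin (N + 1) → EuclideanSpace ℝ (Fin k) → ℂ,
        (∀ j, MemWeightedLp (p j) (w j) (f j)) →
          Integrable (fracIntegrand θ f (powerKernel lam)) ∧
          ‖fracForm θ f (powerKernel lam)‖ ≤ C * ∏ j, (weightedLpNorm (p j) (w j) (f j)).toReal := by
  have hk' : (0 : ℝ) < k := by exact_mod_cast hk
  -- This is where the θ_j being non-zero enters: the forms x and x - θ_j y must differ.
  have hθ : Function.Injective (Fin.cons 0 θ : Fin (N + 1) → ℝ) :=
    Fin.cons_injective_iff.2 ⟨fun ⟨j, hj⟩ ↦ hθ_ne j hj, hθ_inj⟩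
  obtain ⟨C, hC, H⟩ := exists_lintegral_densityIntegrand_le (E := EuclideanSpace ℝ (Fin k))
    (by simpa using hk) hθ (e := fun o ↦ o.elim (lam / k) fun j ↦ w j / k)
    (v := fun j ↦ (p j)⁻¹.toReal) (fun j ↦ ENNReal.toReal_nonneg)
    (fun j ↦ by
      rw [← ENNReal.toReal_one]
      exact ENNReal.toReal_strict_mono ENNReal.one_ne_top (ENNReal.inv_lt_one.2 (hp j)))
    (by
      rw [Finset.sum_add_distrib] at hscale
      simp only [Fintype.sum_option, Option.elim_none, Option.elim_some]
      linarith)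
    hsum hlam_pos hlam_lt hlt
    (by
      simp only [Fintype.sum_option, Option.elim_none, Option.elim_some, ← Finset.sum_div]
      rw [add_sub_cancel_left]
      positivity)
    (fun j ↦ by
      simp only [Fintype.sum_option, Option.elim_none, Option.elim_some, ← Finset.sum_div]
      have := hw_strict j
      rw [Finset.sum_erase_eq_sub (Finset.mem_univ j)] at this
      rw [← add_div, ← sub_div, add_sub_assoc]
      positivity)
  refine ⟨C, hC, fun f hf ↦ ?_⟩
  have hbound : ∫⁻ z, ‖fracIntegrand θ f (powerKernel lam) z‖ₑ
      ≤ ENNReal.ofReal ((∏ j, (weightedLpNorm (p j) (w j) (f j)).toReal) * C) := by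
    -- Some norms may vanish, while the reduction needs M_j > 0: take M_j as the norm plus ε and let
    -- ε → 0.
    have hlim : Filter.Tendsto (fun ε : ℝ ↦ ENNReal.ofReal
        ((∏ j, ((weightedLpNorm (p j) (w j) (f j)).toReal + ε)) * C)) (nhdsWithin 0 (Set.Ioi 0))
        (nhds (ENNReal.ofReal
          ((∏ j, ((weightedLpNorm (p j) (w j) (f j)).toReal + 0)) * C))) := by
      refine (ENNReal.continuous_ofReal.comp ?_).continuousAt.continuousWithinAt.tendsto
      fun_prop
    simp only [add_zero] at hlim
    refine ge_of_tendsto hlim ?_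
    filter_upwards [self_mem_nhdsWithin] with ε hε
    have hε' : 0 < ε := hε
    refine lintegral_fracIntegrand_le hk hθ hp H (fun j ↦ (hf j).1) (fun j ↦ by positivity)
      fun j ↦ ?_
    conv_lhs => rw [← ENNReal.ofReal_toReal (hf j).2.ne]
    exact ENNReal.ofReal_le_ofReal (by linarith)
  have hker : AEStronglyMeasurable (powerKernel (k := k) lam) volume := by
    have : Measurable (powerKernel (k := k) lam) := by unfold powerKernel; fun_prop
    exact this.aestronglyMeasurable
  refine ⟨⟨aestronglyMeasurable_fracIntegrand hθ (fun j ↦ (hf j).1) hker,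
    hbound.trans_lt ENNReal.ofReal_lt_top⟩, ?_⟩
  have h1 := (enorm_integral_le_lintegral_enorm (fracIntegrand θ f (powerKernel lam))).trans hbound
  have h0 : 0 ≤ (∏ j, (weightedLpNorm (p j) (w j) (f j)).toReal) * C :=
    mul_nonneg (Finset.prod_nonneg fun j _ ↦ ENNReal.toReal_nonneg) hC
  rw [← ofReal_norm, ENNReal.ofReal_le_ofReal_iff h0] at h1
  rw [mul_comm]
  exact h1
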